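/- Let $A$ be an abelian group of cardinality strictly less than $2^{\aleph_0}$. Then the following four conditions are equivalent: 1. $A$ is slender: for every homomorphism $\phi:\prod_{\mathbb N}\mathbb Z\to A$ there is a natural number $n$ such that $\phi=\phi\circ p_n$, where $p_n:\prod_{\mathbb N}\mathbb Z\to\bigoplus_{i=1}^n\mathbb Z$ is the projection to the first $n$ coordinates (viewed in $\prod_{\mathbb N}\mathbb Z$ by setting the other coordinates to $0$). 2. $A$ is n-slender (noncommutatively slender): for every homomorphism $\phi:\mathrm{HEG}\to A$ there is a natural number $N$ such that $\phi=\phi\circ p_N$. Here $\mathrm{HEG}$ is the Hawaiian earring group: its elements are the equivalence classes of words $W:\overline W\to\{a_n^{\pm1}\}_{n\in\mathbb N}$, where $\overline W$ is a countable totally ordered set and, for each $N$, only finitely many $i\in\overline W$ satisfy $W(i)\in\{a_n^{\pm1}\}_{n=1}^N$; two words are equivalent if for every $N$ the finite words obtained from them by deleting all letters outside $\{a_n^{\pm1}\}_{n=1}^N$ are equal in the free group on $a_1,\dots,a_N$; multiplication is induced by concatenation; and $p_N:\mathrm{HEG}\to\mathrm{HEG}$ is the homomorphism that deletes from each word all letters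 outside $\{a_n^{\pm1}\}_{n=1}^N$. 3. $A$ is cm-slender: every (not necessarily continuous) group homomorphism from a completely metrizable topological group to $A$ has open kernel. 4. $A$ is lcH-slender: every (not necessarily continuous) group homomorphism from a locally compact Hausdorff topological group to $A$ has open kernel. -/

import Mathlib

namespace HawaiianEarring

/-- A word in the letters `a_n`, `a_n⁻¹` (`n = 0, 1, 2, …`): a function from a countable totally
ordered set to the set of letters in which every letter occurs only finitely often.
The pair `(n, true)` stands for `a_n` and the pair `(n, false)` for `a_n⁻¹`. -/
structure Word : Type 1 where
  carrier : Type
  [order : LinearOrder carrier]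
  [countable : Countable carrier]
  letter : carrier → ℕ × Bool
  finite_letter : ∀ N : ℕ, {i : carrier | (letter i).1 < N}.Finite

attribute [instance] Word.order Word.countable

namespace Word

/-- The finite word obtained from `W` by deleting all letters `a_n`, `a_n⁻¹` with `n ≥ N`. -/
noncomputable def truncList (N : ℕ) (W : Word) : List (ℕ × Bool) :=
  ((W.finite_letter N).toFinset.sort (· ≤ ·)).map W.letter

/-- The finite word `truncList N W`, read in the free group on the letters `a_n`. -/
noncomputable def toFree (N : ℕ) (W : Word) : FreeGroup ℕ :=
  FreeGroup.mk (W.truncList N)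

theorem truncList_eq (N : ℕ) (W : Word) (L : List W.carrier) (hL : L.Pairwise (· < ·))
    (hmem : ∀ i, i ∈ L ↔ (W.letter i).1 < N) : W.truncList N = L.map W.letter := by
  unfold truncList
  congr 1
  have hnd : L.Nodup := hL.imp (fun h => ne_of_lt h)
  refine List.Perm.eq_of_pairwise' (r := (· ≤ ·)) (Finset.pairwise_sort _ _)
    (hL.imp (fun h => le_of_lt h)) ?_
  rw [List.perm_ext_iff_of_nodup (Finset.sort_nodup _ _) hnd]
  intro i
  simp [hmem]

theorem exists_sorted (N : ℕ) (W : Word) : ∃ L : List W.carrier, L.Pairwise (· < ·) ∧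
    (∀ i, i ∈ L ↔ (W.letter i).1 < N) ∧ W.truncList N = L.map W.letter := by
  refine ⟨(W.finite_letter N).toFinset.sort (· ≤ ·), ?_, ?_, rfl⟩
  · exact ((Finset.pairwise_sort _ _).and (Finset.sort_nodup _ _)).imp
      (fun h => lt_of_le_of_ne h.1 h.2)
  · intro i
    simp

/-- The empty word. -/
def empty : Word where
  carrier := Empty
  letter := fun i => i.elim
  finite_letter := fun _ => Set.toFinite _

/-- Concatenation of words: all positions of `W₁` come before all positions of `W₂`. -/
def concat (W₁ W₂ : Word) : Word where
  carrier := W₁.carrier ⊕ₗ W₂.carrier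
  countable := inferInstanceAs (Countable (W₁.carrier ⊕ W₂.carrier))
  letter := fun i => Sum.elim W₁.letter W₂.letter (ofLex i)
  finite_letter := fun N => by
    refine (((W₁.finite_letter N).image (fun i => toLex (Sum.inl i))).union
      ((W₂.finite_letter N).image (fun i => toLex (Sum.inr i)))).subset ?_
    intro i hi
    obtain ⟨i, rfl⟩ := toLex.surjective i
    rcases i with i | i
    · exact Or.inl ⟨i, hi, rfl⟩
    · exact Or.inr ⟨i, hi, rfl⟩

/-- The position in `concat W₁ W₂` of a position in `W₁`. -/
def inl (W₁ W₂ : Word) (i : W₁.carrier) : (concat W₁ W₂).carrier :=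
  (toLex (Sum.inl i) : W₁.carrier ⊕ₗ W₂.carrier)

/-- The position in `concat W₁ W₂` of a position in `W₂`. -/
def inr (W₁ W₂ : Word) (i : W₂.carrier) : (concat W₁ W₂).carrier :=
  (toLex (Sum.inr i) : W₁.carrier ⊕ₗ W₂.carrier)

/-- The inverse word: reverse the order and invert every letter. -/
def inverse (W : Word) : Word where
  carrier := W.carrierᵒᵈ
  countable := inferInstanceAs (Countable W.carrier)
  letter := fun i => ((W.letter (OrderDual.ofDual i)).1, !(W.letter (OrderDual.ofDual i)).2)
  finite_letter := fun N => W.finite_letter N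

/-- The subword of `W` consisting of the letters `a_n`, `a_n⁻¹` with `n < N`. -/
def restrict (N : ℕ) (W : Word) : Word where
  carrier := {i : W.carrier // (W.letter i).1 < N}
  letter := fun i => W.letter i.1
  finite_letter := fun M => (W.finite_letter M).preimage Subtype.val_injective.injOn

theorem toFree_empty (N : ℕ) : toFree N empty = 1 := by
  unfold toFree
  rw [truncList_eq N empty [] List.Pairwise.nil (fun i => i.elim)]
  rfl

theorem toFree_concat (N : ℕ) (W₁ W₂ : Word) :
    toFree N (concat W₁ W₂) = toFree N W₁ * toFree N W₂ := by
  obtain ⟨L₁, hs₁, hm₁, h₁⟩ := exists_sorted N W₁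
  obtain ⟨L₂, hs₂, hm₂, h₂⟩ := exists_sorted N W₂
  have hl : (concat W₁ W₂).letter ∘ inl W₁ W₂ = W₁.letter := rfl
  have hr : (concat W₁ W₂).letter ∘ inr W₁ W₂ = W₂.letter := rfl
  have hinjl : Function.Injective (inl W₁ W₂) := fun _ _ h => Sum.inl_injective (toLex.injective h)
  have hinjr : Function.Injective (inr W₁ W₂) := fun _ _ h => Sum.inr_injective (toLex.injective h)
  have hne : ∀ i j, inl W₁ W₂ i ≠ inr W₁ W₂ j := fun _ _ h => Sum.inl_ne_inr (toLex.injective h)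
  unfold toFree
  rw [FreeGroup.mul_mk, h₁, h₂, truncList_eq N (concat W₁ W₂)
    (L₁.map (inl W₁ W₂) ++ L₂.map (inr W₁ W₂)), List.map_append, List.map_map, List.map_map,
    hl, hr]
  · rw [List.pairwise_append, List.pairwise_map, List.pairwise_map]
    refine ⟨hs₁.imp (fun h => Sum.Lex.inl_lt_inl_iff.2 h),
      hs₂.imp (fun h => Sum.Lex.inr_lt_inr_iff.2 h), ?_⟩
    intro x hx y hy
    obtain ⟨i, -, rfl⟩ := List.mem_map.1 hx
    obtain ⟨j, -, rfl⟩ := List.mem_map.1 hy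
    exact Sum.Lex.inl_lt_inr i j
  · have key : ∀ i : W₁.carrier ⊕ W₂.carrier,
        ((toLex i : W₁.carrier ⊕ₗ W₂.carrier) : (concat W₁ W₂).carrier) ∈
          L₁.map (inl W₁ W₂) ++ L₂.map (inr W₁ W₂) ↔
          ((concat W₁ W₂).letter (toLex i : W₁.carrier ⊕ₗ W₂.carrier)).1 < N := by
      rintro (i | i)
      · change inl W₁ W₂ i ∈ _ ↔ (W₁.letter i).1 < N
        simp [← hm₁, hinjl.eq_iff, (hne _ _).symm]
      · change inr W₁ W₂ i ∈ _ ↔ (W₂.letter i).1 < N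
        simp [← hm₂, hinjr.eq_iff, hne]
    exact key

theorem toFree_inverse (N : ℕ) (W : Word) : toFree N (inverse W) = (toFree N W)⁻¹ := by
  obtain ⟨L, hs, hm, h⟩ := exists_sorted N W
  let d : W.carrier → (inverse W).carrier := OrderDual.toDual
  unfold toFree
  rw [FreeGroup.inv_mk, h, truncList_eq N (inverse W) (L.reverse.map d)]
  · rw [FreeGroup.invRev, List.map_map, List.map_map, List.map_reverse]
    rfl
  · rw [List.pairwise_map, List.pairwise_reverse]
    exact hs.imp (fun h => OrderDual.toDual_lt_toDual.2 h)
  · intro i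
    change _ ↔ (W.letter (OrderDual.ofDual i)).1 < N
    rw [← hm, List.mem_map]
    constructor
    · rintro ⟨j, hj, rfl⟩
      exact List.mem_reverse.1 hj
    · intro hi
      exact ⟨_, List.mem_reverse.2 hi, rfl⟩

theorem toFree_restrict (M N : ℕ) (W : Word) :
    toFree M (restrict N W) = toFree (min M N) W := by
  obtain ⟨L, hs, hm, h⟩ := exists_sorted M (restrict N W)
  let f : (restrict N W).carrier → W.carrier := Subtype.val
  unfold toFree
  rw [h, truncList_eq (min M N) W (L.map f)]
  · rw [List.map_map]
    rfl
  · rw [List.pairwise_map]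
    exact hs.imp (fun h => h)
  · intro i
    rw [List.mem_map, lt_min_iff]
    constructor
    · rintro ⟨j, hj, rfl⟩
      exact ⟨(hm j).1 hj, j.2⟩
    · rintro ⟨h1, h2⟩
      exact ⟨⟨i, h2⟩, (hm _).2 h1, rfl⟩

/-- Two words are equivalent if for every `N` their truncations to the letters
`a_n`, `a_n⁻¹` with `n < N` are equal in the free group. -/
instance setoid : Setoid Word where
  r W₁ W₂ := ∀ N, toFree N W₁ = toFree N W₂
  iseqv := ⟨fun _ _ => rfl, fun h N => (h N).symm, fun h₁ h₂ N => (h₁ N).trans (h₂ N)⟩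

end Word

/-- The Hawaiian earring group: words modulo equivalence, under concatenation. -/
def HEG : Type 1 := Quotient Word.setoid

namespace HEG

/-- The class of a word. -/
def mk (W : Word) : HEG := Quotient.mk Word.setoid W

theorem sound {W₁ W₂ : Word} (h : ∀ N, W₁.toFree N = W₂.toFree N) : mk W₁ = mk W₂ :=
  Quotient.sound h

instance : Mul HEG where
  mul := Quotient.map₂ Word.concat (fun _ _ h₁ _ _ h₂ N => by
    rw [Word.toFree_concat, Word.toFree_concat, h₁ N, h₂ N])

instance : One HEG where
  one := mk Word.empty

instance : Inv HEG where
  inv := Quotient.map Word.inverse (fun _ _ h N => by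
    rw [Word.toFree_inverse, Word.toFree_inverse, h N])

theorem mk_mul (W₁ W₂ : Word) : mk W₁ * mk W₂ = mk (W₁.concat W₂) := rfl

theorem one_def : (1 : HEG) = mk Word.empty := rfl

theorem mk_inv (W : Word) : (mk W)⁻¹ = mk W.inverse := rfl

instance : Group HEG :=
  Group.ofLeftAxioms
    (fun a b c => by
      induction a using Quotient.inductionOn with | _ U
      induction b using Quotient.inductionOn with | _ V
      induction c using Quotient.inductionOn with | _ W
      exact sound (fun N => by simp only [Word.toFree_concat, mul_assoc]))
    (fun a => by
      induction a using Quotient.inductionOn with | _ U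
      exact sound (fun N => by rw [Word.toFree_concat, Word.toFree_empty, one_mul]))
    (fun a => by
      induction a using Quotient.inductionOn with | _ U
      exact sound (fun N => by
        rw [Word.toFree_concat, Word.toFree_inverse, Word.toFree_empty, inv_mul_cancel]))

/-- The retraction `p_N` of the Hawaiian earring group onto the free subgroup on the first
`N` letters, given by deleting all other letters from a word. -/
def retract (N : ℕ) : HEG →* HEG :=
  MonoidHom.mk' (Quotient.map (Word.restrict N) (fun _ _ h M => by
      rw [Word.toFree_restrict, Word.toFree_restrict, h]))
    (fun a b => by
      induction a using Quotient.inductionOn with | _ U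
      induction b using Quotient.inductionOn with | _ V
      exact sound (fun M => by simp only [Word.toFree_concat, Word.toFree_restrict]))

theorem retract_mk (N : ℕ) (W : Word) : retract N (mk W) = mk (W.restrict N) := rfl

end HEG

end HawaiianEarring

/-- An abelian group `A` is slender if every homomorphism from the group of all integer
sequences to `A` factors through the projection to finitely many coordinates. -/
def IsSlender (A : Type*) [AddCommGroup A] : Prop :=
  ∀ φ : (ℕ → ℤ) →+ A, ∃ n : ℕ, ∀ x : ℕ → ℤ, φ x = φ (fun i => if i < n then x i else 0)

/-- A group `G` is n-slender (noncommutatively slender) if every homomorphism `φ` from the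
Hawaiian earring group to `G` satisfies `φ = φ ∘ p_N` for some `N`. -/
def IsNSlender (G : Type*) [Group G] : Prop :=
  ∀ φ : HawaiianEarring.HEG →* G, ∃ N : ℕ, φ = φ.comp (HawaiianEarring.HEG.retract N)

universe u v w

/-- A group `G` is cm-slender if every abstract homomorphism from a completely metrizable
topological group (in the universe `v`) to `G` has open kernel. -/
def IsCMSlender (G : Type u) [Group G] : Prop :=
  ∀ (H : Type v) [Group H] [TopologicalSpace H] [IsTopologicalGroup H]
    [TopologicalSpace.IsCompletelyMetrizableSpace H] (φ : H →* G), IsOpen (φ.ker : Set H)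

/-- A group `G` is lcH-slender if every abstract homomorphism from a locally compact Hausdorff
topological group (in the universe `v`) to `G` has open kernel. -/
def IsLCHSlender (G : Type u) [Group G] : Prop :=
  ∀ (H : Type v) [Group H] [TopologicalSpace H] [IsTopologicalGroup H]
    [LocallyCompactSpace H] [T2Space H] (φ : H →* G), IsOpen (φ.ker : Set H)

/-! Each of the four conditions is equivalent to `IsTorsionFreeReduced A`; the cardinality bound is
used only to deduce slenderness from it. Suppose `φ` maps a topological monoid to such an `A` and is
nontrivial arbitrarily near 1. Choose `x n` tending to 1 fast and `m n ≠ 0` such that `φ (x n)` is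
not divisible by `m n`. For every 0-1 sequence `ε`, completeness or compactness yields a nested
infinite product `g n = x n ^ ε n * g (n + 1) ^ m n`. The image of `g 0` in `A` determines `ε`
(`false_of_nested`), so `A` has at least continuum many elements, a contradiction. Monoids rather
than groups are used so that the argument also covers the inverse limit of free monoids of finite
words. It is completely metrizable and maps to HEG, which gives n-slenderness. Conversely, torsion
or a nonzero divisible element of `A` produces a bad homomorphism from `ℤ^ℕ`, or from `(ZMod p)^ℕ`
or `ℝ`. Exponent sums reduce n-slenderness to `ℤ^ℕ`. -/

open Filter Topology

/-! ### Counting nested infinite products. -/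

/-- The abelian group `A` is torsion-free and no nonzero element of `A` is divisible by all
nonzero integers. -/
structure IsTorsionFreeReduced (A : Type*) [AddCommGroup A] : Prop where
  eq_zero_of_nsmul : ∀ n : ℕ, n ≠ 0 → ∀ a : A, n • a = 0 → a = 0
  exists_not_divisible : ∀ a : A, a ≠ 0 → ∃ m : ℕ, m ≠ 0 ∧ ∀ b : A, m • b ≠ a

namespace IsTorsionFreeReduced

/-- A system of elements satisfying the recursion of infinite nested products cannot exist for all
choices `ε` of exponents in a group with fewer than continuum many elements. -/
theorem false_of_nested {A : Type u} [AddCommGroup A] (h : IsTorsionFreeReduced A)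
    (hA : Cardinal.mk A < Cardinal.continuum.{u}) (a : ℕ → A) (m : ℕ → ℕ) (hm : ∀ n, m n ≠ 0)
    (hdiv : ∀ n b, m n • b ≠ a n) (f : (ℕ → Bool) → ℕ → A)
    (hf : ∀ ε n, f ε n = (bif ε n then a n else 0) + m n • f ε (n + 1)) : False := by
  have hninj : ¬ Function.Injective (fun ε => f ε 0) := by
    intro hinj
    have := Cardinal.mk_le_of_injective
      (f := fun ε : ULift.{u} (ℕ → Bool) => f ε.down 0) (fun x y hxy => ULift.down_injective (hinj hxy))
    refine absurd this (not_le.2 ?_)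
    simpa using hA
  simp only [Function.Injective, not_forall] at hninj
  obtain ⟨ε, δ, h0, hne⟩ := hninj
  have hex : ∃ n, ε n ≠ δ n := Function.ne_iff.1 hne
  classical
  -- Before the first disagreement `k` the summands agree and torsion-freeness cancels the factors
  -- `m n`, so equality at 0 travels up to `k`. There exactly one expansion contains `a k`, which
  -- makes `a k` divisible by `m k`.
  let k := Nat.find hex
  have hlt : ∀ n < k, ε n = δ n := fun n hn => not_not.1 (Nat.find_min hex hn)
  have heq : ∀ n ≤ k, f ε n = f δ n := by
    intro n
    induction n with
    | zero => exact fun _ => h0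
    | succ n ih =>
      intro hn
      have h1 := ih (by omega)
      rw [hf ε, hf δ, hlt n (by omega), add_left_cancel_iff, ← sub_eq_zero, ← smul_sub] at h1
      exact sub_eq_zero.1 (h.eq_zero_of_nsmul _ (hm n) _ h1)
  have hk := heq k le_rfl
  have hdk : ε k ≠ δ k := Nat.find_spec hex
  rw [hf ε, hf δ] at hk
  cases h1 : ε k <;> cases h2 : δ k <;> simp only [h1, h2, cond_true, cond_false, zero_add,
    ne_eq, not_true_eq_false] at hk hdk
  · exact hdiv k (f ε (k + 1) - f δ (k + 1)) (by rw [smul_sub, hk, add_sub_cancel_right])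
  · exact hdiv k (f δ (k + 1) - f ε (k + 1)) (by rw [smul_sub, ← hk, add_sub_cancel_right])

theorem false_of_nested_monoidHom {A : Type u} [AddCommGroup A] (h : IsTorsionFreeReduced A)
    (hA : Cardinal.mk A < Cardinal.continuum.{u}) {M : Type*} [Monoid M]
    (φ : M →* Multiplicative A) (x : ℕ → M) (m : ℕ → ℕ) (hm : ∀ n, m n ≠ 0)
    (hdiv : ∀ n b, b ^ m n ≠ φ (x n))
    (hg : ∀ ε : ℕ → Bool, ∃ g : ℕ → M, ∀ n, g n = (bif ε n then x n else 1) * g (n + 1) ^ m n) :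
    False := by
  choose g hg using hg
  refine h.false_of_nested hA (fun n => (φ (x n)).toAdd) m hm
    (fun n b hb => hdiv n (Multiplicative.ofAdd b) hb) (fun ε n => (φ (g ε n)).toAdd) ?_
  intro ε n
  rw [hg ε n]
  cases ε n <;> simp

theorem exists_not_pow {A : Type*} [AddCommGroup A] (h : IsTorsionFreeReduced A)
    {a : Multiplicative A} (ha : a ≠ 1) : ∃ m : ℕ, m ≠ 0 ∧ ∀ b, b ^ m ≠ a :=
  h.exists_not_divisible a.toAdd ha

end IsTorsionFreeReduced

/-! ### Completely metrizable monoids. -/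

section CompletelyMetrizable

variable {M : Type*} [Monoid M]

/-- The composition of the maps `x ↦ c i * x ^ m i` for `j ≤ i < j + k`. -/
def nestedPow (c : ℕ → M) (m : ℕ → ℕ) (j : ℕ) : ℕ → M → M
  | 0, x => x
  | k + 1, x => nestedPow c m j k (c (j + k) * x ^ m (j + k))

/-- The definition grows at the innermost place; peeling off the outermost factor instead gives the
recursion that survives the limit `k → ∞`. -/
theorem nestedPow_succ (c : ℕ → M) (m : ℕ → ℕ) (j k : ℕ) (x : M) :
    nestedPow c m j (k + 1) x = c j * nestedPow c m (j + 1) k x ^ m j := by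
  induction k generalizing x with
  | zero => rfl
  | succ k ih =>
    rw [nestedPow, ih, nestedPow, show j + 1 + k = j + (k + 1) by omega]

/-- The hypothesis bounds consecutive terms of `k ↦ nestedPow c m j k 1`, since one further step
applied to 1 inserts `c (j + k)`. The limits over `k` satisfy the recursion by continuity. -/
theorem exists_nested_of_dist_lt [MetricSpace M] [CompleteSpace M] [ContinuousMul M]
    (c : ℕ → M) (m : ℕ → ℕ)
    (h : ∀ j k, dist (nestedPow c m j k 1) (nestedPow c m j k (c (j + k))) ≤ (1 / 2) ^ (j + k)) :
    ∃ g : ℕ → M, ∀ n, g n = c n * g (n + 1) ^ m n := by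
  have hcau : ∀ j, CauchySeq (fun k => nestedPow c m j k 1) := by
    intro j
    refine cauchySeq_of_le_geometric (1 / 2) 1 (by norm_num) (fun k => ?_)
    rw [nestedPow, one_pow, mul_one, one_mul]
    exact (h j k).trans (pow_le_pow_of_le_one (by norm_num) (by norm_num) (by omega))
  choose g hg using fun j => cauchySeq_tendsto_of_complete (hcau j)
  refine ⟨g, fun n => tendsto_nhds_unique ((tendsto_add_atTop_iff_nat 1).2 (hg n)) ?_⟩
  simp only [nestedPow_succ]
  exact ((hg (n + 1)).pow (m n)).const_mul (c n)

/-- The maps `nestedPow c m j k` with `j + k = n`, over all sequences `c` with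
`c i ∈ {x i, 1}`. -/
def nestedPowMaps (x : ℕ → M) (m : ℕ → ℕ) : ℕ → Set (M → M)
  | 0 => {id}
  | n + 1 => insert id ((fun F : M → M => fun y => F (x n * y ^ m n)) '' nestedPowMaps x m n ∪
      (fun F : M → M => fun y => F (1 * y ^ m n)) '' nestedPowMaps x m n)

theorem nestedPow_mem_nestedPowMaps (x : ℕ → M) (m : ℕ → ℕ) (c : ℕ → M)
    (hc : ∀ i, c i = x i ∨ c i = 1) (j k : ℕ) :
    nestedPow c m j k ∈ nestedPowMaps x m (j + k) := by
  induction k with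
  | zero =>
    cases j with
    | zero => rfl
    | succ j => exact Or.inl rfl
  | succ k ih =>
    refine Or.inr ?_
    rcases hc (j + k) with h | h
    · refine Or.inl ⟨_, ih, ?_⟩
      funext y
      simp only [nestedPow, h, Nat.add_eq]
    · refine Or.inr ⟨_, ih, ?_⟩
      funext y
      simp only [nestedPow, h, Nat.add_eq]

/-- A homomorphism from a completely metrizable topological monoid to a torsion-free reduced
abelian group with fewer than continuum many elements is trivial near the identity. -/
theorem IsTorsionFreeReduced.eventually_eq_one_of_isCompletelyMetrizable {A : Type u}
    [AddCommGroup A] (h : IsTorsionFreeReduced A)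
    (hA : Cardinal.mk A < Cardinal.continuum.{u}) [TopologicalSpace M] [ContinuousMul M]
    [TopologicalSpace.IsCompletelyMetrizableSpace M] (φ : M →* Multiplicative A) :
    ∀ᶠ x in 𝓝 1, φ x = 1 := by
  let _ := TopologicalSpace.upgradeIsCompletelyMetrizable M
  by_contra hcon
  -- The next `x n` must be close to 1 under every composite that may surround it, whatever `ε` and
  -- the starting index are. These are finitely many continuous maps.
  have hstep : ∀ (S : {S : Set (M → M) // S.Finite ∧ ∀ F ∈ S, Continuous F}) (n : ℕ),
      ∃ p : M × ℕ, p.2 ≠ 0 ∧ (∀ b, b ^ p.2 ≠ φ p.1) ∧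
        ∀ F ∈ S.1, dist (F 1) (F p.1) ≤ (1 / 2) ^ n := by
    intro S n
    have hev : ∀ᶠ y in 𝓝 (1 : M), ∀ F ∈ S.1, dist (F 1) (F y) ≤ (1 / 2) ^ n := by
      rw [S.2.1.eventually_all]
      intro F hF
      have hc := (S.2.2 F hF).tendsto 1
      filter_upwards [hc.eventually (Metric.ball_mem_nhds (F 1) (ε := (1 / 2) ^ n) (by positivity))]
        with y hy
      rw [dist_comm]
      exact (Metric.mem_ball.1 hy).le
    obtain ⟨y, hy1, hy2⟩ := ((not_eventually.1 hcon).and_eventually hev).exists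
    obtain ⟨k, hk, hkb⟩ := h.exists_not_pow hy1
    exact ⟨(y, k), hk, hkb, hy2⟩
  choose p hp0 hpdiv hpdist using hstep
  -- This copies the recursion of `nestedPowMaps`, which cannot be used yet because `x` and `m` are
  -- still being chosen.
  let next (S : Set (M → M)) (q : M × ℕ) : Set (M → M) :=
    insert id ((fun F : M → M => fun y => F (q.1 * y ^ q.2)) '' S ∪
      (fun F : M → M => fun y => F (1 * y ^ q.2)) '' S)
  let S : ℕ → {S : Set (M → M) // S.Finite ∧ ∀ F ∈ S, Continuous F} := fun n =>
    Nat.rec ⟨{id}, Set.finite_singleton _, fun F hF => by rw [hF]; exact continuous_id⟩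
      (fun n S => ⟨next S.1 (p S n),
        ((S.2.1.image _).union (S.2.1.image _)).insert _, by
          rintro F (rfl | ⟨F, hF, rfl⟩ | ⟨F, hF, rfl⟩)
          · exact continuous_id
          · exact (S.2.2 F hF).comp (by fun_prop)
          · exact (S.2.2 F hF).comp (by fun_prop)⟩) n
  let x : ℕ → M := fun n => (p (S n) n).1
  let m : ℕ → ℕ := fun n => (p (S n) n).2
  have hS : ∀ n, (S n).1 = nestedPowMaps x m n := by
    intro n
    induction n with
    | zero => rfl
    | succ n ih =>
      rw [nestedPowMaps, ← ih]
  refine h.false_of_nested_monoidHom hA φ x m (fun n => hp0 _ _) (fun n => hpdiv _ _) ?_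
  intro ε
  refine exists_nested_of_dist_lt (fun n => bif ε n then x n else 1) m ?_
  intro j k
  have hmem := nestedPow_mem_nestedPowMaps x m (fun n => bif ε n then x n else 1)
    (fun i => by cases ε i <;> simp) j k
  cases hε : ε (j + k)
  · simp
  · simp only [cond_true]
    rw [← hS] at hmem
    exact hpdist (S (j + k)) (j + k) _ hmem

end CompletelyMetrizable

/-! ### Locally compact Hausdorff monoids. -/

section LocallyCompact

variable {M : Type*} [Monoid M] [TopologicalSpace M]

/-- The points of the compact product of the `U n` that satisfy the first `N` equations form a
decreasing sequence of nonempty compact sets; a common point solves all equations. -/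
theorem exists_nested_of_isCompact [ContinuousMul M] [T2Space M] (c : ℕ → M) (m : ℕ → ℕ)
    (U : ℕ → Set M) (hU : ∀ n, IsCompact (U n)) (h1 : ∀ n, 1 ∈ U n)
    (h : ∀ n, ∀ y ∈ U (n + 1), c n * y ^ m n ∈ U n) :
    ∃ g : ℕ → M, ∀ n, g n = c n * g (n + 1) ^ m n := by
  let T : ℕ → Set (ℕ → M) := fun N =>
    {g | g ∈ Set.pi Set.univ U ∧ ∀ n < N, g n = c n * g (n + 1) ^ m n}
  have hclosed : ∀ N, IsClosed {g : ℕ → M | ∀ n < N, g n = c n * g (n + 1) ^ m n} := by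
    intro N
    simp only [Set.ofPred_forall]
    exact isClosed_iInter fun n => isClosed_iInter fun _ =>
      isClosed_eq (by fun_prop) (by fun_prop)
  have hcomp : ∀ N, IsCompact (T N) := fun N =>
    (isCompact_univ_pi hU).inter_right (hclosed N)
  have hne : ∀ N, (T N).Nonempty := by
    intro N
    -- The equations below `N` are solved backwards from the constant sequence 1; `h` keeps each new
    -- value in its `U n`.
    have key : ∀ d j, j + d = N → ∃ g : ℕ → M, (∀ n, g n ∈ U n) ∧
        ∀ n, j ≤ n → n < N → g n = c n * g (n + 1) ^ m n := by
      intro d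
      induction d with
      | zero => exact fun j hj => ⟨fun _ => 1, h1, fun n hn hN => by omega⟩
      | succ d ih =>
        intro j hj
        obtain ⟨g, hgU, hg⟩ := ih (j + 1) (by omega)
        refine ⟨Function.update g j (c j * g (j + 1) ^ m j), fun n => ?_, fun n hn hN => ?_⟩
        · rcases eq_or_ne n j with rfl | hnj
          · rw [Function.update_self]
            exact h n _ (hgU _)
          · rw [Function.update_of_ne hnj]
            exact hgU n
        · rw [Function.update_of_ne (show n + 1 ≠ j by omega)]
          rcases eq_or_ne n j with rfl | hnj
          · rw [Function.update_self]
          · rw [Function.update_of_ne hnj]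
            exact hg n (by omega) hN
    obtain ⟨g, hgU, hg⟩ := key N 0 (by omega)
    exact ⟨g, fun n _ => hgU n, fun n hn => hg n (Nat.zero_le n) hn⟩
  obtain ⟨g, hg⟩ := IsCompact.nonempty_iInter_of_sequence_nonempty_isCompact_isClosed T
    (fun N g hg => ⟨hg.1, fun n hn => hg.2 n (by omega)⟩) hne (hcomp 0)
    (fun N => (hcomp N).isClosed)
  exact ⟨g, fun n => (Set.mem_iInter.1 hg (n + 1)).2 n (Nat.lt_succ_self n)⟩

/-- A homomorphism from a locally compact Hausdorff topological monoid to a torsion-free reduced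
abelian group with fewer than continuum many elements is trivial near the identity. -/
theorem IsTorsionFreeReduced.eventually_eq_one_of_locallyCompact {A : Type u}
    [AddCommGroup A] (h : IsTorsionFreeReduced A)
    (hA : Cardinal.mk A < Cardinal.continuum.{u}) [ContinuousMul M]
    [LocallyCompactSpace M] [T2Space M] (φ : M →* Multiplicative A) :
    ∀ᶠ x in 𝓝 1, φ x = 1 := by
  by_contra hcon
  have hstep : ∀ (U : {U : Set M // IsCompact U ∧ U ∈ 𝓝 (1 : M)}),
      ∃ p : M × ℕ, p.2 ≠ 0 ∧ (∀ b, b ^ p.2 ≠ φ p.1) ∧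
        ∃ V : {U : Set M // IsCompact U ∧ U ∈ 𝓝 (1 : M)},
          ∀ y ∈ V.1, p.1 * y ^ p.2 ∈ U.1 ∧ y ^ p.2 ∈ U.1 := by
    rintro ⟨U, hU, hU1⟩
    -- Taking `y` in the interior of `U` ensures that `v ↦ y * v ^ k` maps a neighbourhood of 1 into
    -- `U`.
    obtain ⟨y, hy1, hy2⟩ := ((not_eventually.1 hcon).and_eventually
      (eventually_mem_nhds_iff.2 hU1)).exists
    obtain ⟨k, hk, hkb⟩ := h.exists_not_pow hy1
    have hc : ∀ z : M, U ∈ 𝓝 z → ∀ᶠ v in 𝓝 (1 : M), z * v ^ k ∈ U := by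
      intro z hz
      have : Continuous fun v : M => z * v ^ k := by fun_prop
      refine this.tendsto 1 |>.eventually ?_
      simpa using hz
    obtain ⟨V, hV, hVU, hVc⟩ := local_compact_nhds ((hc y hy2).and (hc 1 hU1))
    exact ⟨(y, k), hk, hkb, ⟨V, hVc, hV⟩, fun v hv =>
      ⟨(hVU hv).1, by simpa using (hVU hv).2⟩⟩
  choose p hp0 hpdiv V hV using hstep
  obtain ⟨K, hK, hK1⟩ := exists_compact_mem_nhds (1 : M)
  let U : ℕ → {U : Set M // IsCompact U ∧ U ∈ 𝓝 (1 : M)} := fun n =>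
    Nat.rec ⟨K, hK, hK1⟩ (fun _ U => V U) n
  refine h.false_of_nested_monoidHom hA φ (fun n => (p (U n)).1) (fun n => (p (U n)).2)
    (fun n => hp0 _) (fun n => hpdiv _) (fun ε => ?_)
  refine exists_nested_of_isCompact _ _ (fun n => (U n).1) (fun n => (U n).2.1)
    (fun n => mem_of_mem_nhds (U n).2.2) (fun n y hy => ?_)
  cases ε n
  · simpa using (hV (U n) y hy).2
  · exact (hV (U n) y hy).1

end LocallyCompact

namespace IsTorsionFreeReduced

variable {A : Type u} [AddCommGroup A]

theorem isCMSlender (h : IsTorsionFreeReduced A)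
    (hA : Cardinal.mk A < Cardinal.continuum.{u}) : IsCMSlender.{u, v} (Multiplicative A) := by
  intro H _ _ _ _ φ
  exact Subgroup.isOpen_of_mem_nhds _ (h.eventually_eq_one_of_isCompletelyMetrizable hA φ)

theorem isLCHSlender (h : IsTorsionFreeReduced A)
    (hA : Cardinal.mk A < Cardinal.continuum.{u}) : IsLCHSlender.{u, w} (Multiplicative A) := by
  intro H _ _ _ _ _ φ
  exact Subgroup.isOpen_of_mem_nhds _ (h.eventually_eq_one_of_locallyCompact hA φ)

end IsTorsionFreeReduced

/-! ### Test homomorphisms detecting torsion and divisibility. -/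

/-- The coordinate sum makes sense on finitely supported sequences; a linear retraction onto these
extends it to all sequences. -/
theorem exists_linearMap_single_eq_one (K : Type*) [Field K] :
    ∃ f : (ℕ → K) →ₗ[K] K, ∀ n, f (Pi.single n 1) = 1 := by
  classical
  obtain ⟨g, hg⟩ := LinearMap.exists_leftInverse_of_injective
    (Finsupp.lcoeFun : (ℕ →₀ K) →ₗ[K] ℕ → K) (LinearMap.ker_eq_bot.2 DFunLike.coe_injective)
  refine ⟨(Finsupp.lsum K fun _ => LinearMap.id) ∘ₗ g, fun n => ?_⟩
  have h1 : g (Pi.single n 1) = Finsupp.single n 1 := by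
    rw [← Finsupp.single_eq_pi_single]
    exact LinearMap.congr_fun hg (Finsupp.single n 1)
  simp [h1]

/-- The elements of an abelian group divisible by every nonzero integer. -/
def divisibleElements (A : Type*) [AddCommGroup A] : AddSubgroup A where
  carrier := {a | ∀ m : ℕ, m ≠ 0 → ∃ b : A, m • b = a}
  zero_mem' := fun m _ => ⟨0, smul_zero m⟩
  add_mem' := fun {a b} ha hb m hm => by
    obtain ⟨c, rfl⟩ := ha m hm
    obtain ⟨d, rfl⟩ := hb m hm
    exact ⟨c + d, smul_add m c d⟩
  neg_mem' := fun {a} ha m hm => by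
    obtain ⟨c, rfl⟩ := ha m hm
    exact ⟨-c, smul_neg m c⟩

/-- Without torsion quotients are unique: if `n • b = a` and `(n * k) • c = a`, then `k • c = b`.
Hence the quotient `b` is again divisible, and divisible groups are injective. -/
theorem baer_divisibleElements {A : Type*} [AddCommGroup A]
    (hA : ∀ n : ℕ, n ≠ 0 → ∀ a : A, n • a = 0 → a = 0) :
    Module.Baer ℤ (divisibleElements A) := by
  have key : ∀ (n : ℕ), n ≠ 0 → ∀ a : divisibleElements A, ∃ b : divisibleElements A,
      n • b = a := by
    rintro n hn ⟨a, ha⟩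
    obtain ⟨b, rfl⟩ := ha n hn
    refine ⟨⟨b, fun k hk => ?_⟩, rfl⟩
    obtain ⟨c, hc⟩ := ha (n * k) (mul_ne_zero hn hk)
    refine ⟨c, sub_eq_zero.1 (hA n hn _ ?_)⟩
    rw [smul_sub, smul_smul, hc, sub_self]
  have key' : ∀ (n : ℤ), n ≠ 0 → ∀ a : divisibleElements A, ∃ b : divisibleElements A,
      n • b = a := by
    intro n hn a
    obtain ⟨b, hb⟩ := key n.natAbs (Int.natAbs_ne_zero.2 hn) a
    rcases Int.natAbs_eq n with h | h
    · exact ⟨b, by rw [h, natCast_zsmul, hb]⟩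
    · exact ⟨-b, by rw [h, neg_smul, smul_neg, neg_neg, natCast_zsmul, hb]⟩
  choose! d hd using key'
  let _ : DivisibleBy (divisibleElements A) ℤ :=
    { div := fun a n => if n = 0 then 0 else d n a
      div_zero := fun a => if_pos rfl
      div_cancel := fun {n} a hn => by rw [if_neg hn]; exact hd n hn a }
  exact Module.Baer.of_divisible _

theorem exists_prime_nsmul_eq_zero {A : Type*} [AddCommGroup A] {n : ℕ} (hn : n ≠ 0) {a : A}
    (ha : a ≠ 0) (h : n • a = 0) : ∃ (p : ℕ) (b : A), p.Prime ∧ b ≠ 0 ∧ p • b = 0 := by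
  have h0 : addOrderOf a ≠ 0 := fun h0 =>
    hn (Nat.eq_zero_of_zero_dvd (h0 ▸ addOrderOf_dvd_of_nsmul_eq_zero h))
  have h1 : addOrderOf a ≠ 1 := fun h1 => ha (AddMonoid.addOrderOf_eq_one_iff.1 h1)
  obtain ⟨p, hp, k, hk⟩ := Nat.exists_prime_and_dvd h1
  refine ⟨p, k • a, hp, fun hka => ?_, by rw [smul_smul, ← hk, addOrderOf_nsmul_eq_zero]⟩
  have hdvd := Nat.le_of_dvd (Nat.pos_of_ne_zero fun hk0 => h0 (by rw [hk, hk0, mul_zero]))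
    (addOrderOf_dvd_of_nsmul_eq_zero hka)
  have hkpos : 0 < k := Nat.pos_of_ne_zero fun hk0 => h0 (by rw [hk, hk0, mul_zero])
  rw [hk] at hdvd
  nlinarith [hp.two_le]

/-- If `A` has torsion, then for some prime `p` there is a homomorphism from `(ZMod p)^ℕ` to `A`
that does not kill any of the standard basis vectors. -/
theorem exists_addMonoidHom_of_torsion {A : Type*} [AddCommGroup A] {n : ℕ} (hn : n ≠ 0) {a : A}
    (ha : a ≠ 0) (h : n • a = 0) :
    ∃ (p : ℕ) (_ : p.Prime) (φ : (ℕ → ZMod p) →+ A), ∀ i, φ (Pi.single i 1) ≠ 0 := by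
  obtain ⟨p, b, hp, hb, hpb⟩ := exists_prime_nsmul_eq_zero hn ha h
  have := Fact.mk hp
  obtain ⟨f, hf⟩ := exists_linearMap_single_eq_one (ZMod p)
  let ψ : ZMod p →+ A := ZMod.lift p ⟨zmultiplesHom A b, by simpa using hpb⟩
  refine ⟨p, hp, ψ.comp f.toAddMonoidHom, fun i => ?_⟩
  have h1 : ψ 1 = b := by
    have := ZMod.lift_coe p ⟨zmultiplesHom A b, by simpa using hpb⟩ 1
    simpa using this
  simpa [hf, h1] using hb

theorem exists_not_divisible_of_forall {A : Type*} [AddCommGroup A]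
    (h : ∀ a ∈ divisibleElements A, a = 0) (a : A) (ha : a ≠ 0) :
    ∃ m : ℕ, m ≠ 0 ∧ ∀ b : A, m • b ≠ a := by
  by_contra! hcon
  exact ha (h a hcon)

/-! ### Slenderness conditions force torsion-free and reduced. -/

theorem IsSlender.exists_apply_single_eq_zero {A : Type*} [AddCommGroup A] (h : IsSlender A)
    (φ : (ℕ → ℤ) →+ A) : ∃ i, φ (Pi.single i 1) = 0 := by
  obtain ⟨n, hn⟩ := h φ
  refine ⟨n, ?_⟩
  rw [hn, ← φ.map_zero]
  congr 1
  funext i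
  split_ifs with hi
  · exact Pi.single_eq_of_ne hi.ne _
  · rfl

/-- In either bad case some homomorphism from `ℤ^ℕ` is nonzero on all unit vectors: reduction mod
`p` followed by the torsion test map, or an extension by injectivity of the map sending every unit
vector to a divisible `a ≠ 0`. -/
theorem IsSlender.isTorsionFreeReduced {A : Type*} [AddCommGroup A] (h : IsSlender A) :
    IsTorsionFreeReduced A := by
  have htf : ∀ n : ℕ, n ≠ 0 → ∀ a : A, n • a = 0 → a = 0 := by
    intro n hn a hna
    by_contra ha
    obtain ⟨p, hp, φ, hφ⟩ := exists_addMonoidHom_of_torsion hn ha hna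
    obtain ⟨i, hi⟩ := h.exists_apply_single_eq_zero
      (φ.comp ((Int.castAddHom (ZMod p)).compLeft ℕ))
    refine hφ i (Eq.trans (congrArg φ ?_) hi)
    funext j
    rcases eq_or_ne j i with rfl | hj
    · simp
    · simp [hj]
  refine ⟨htf, exists_not_divisible_of_forall fun a ha => ?_⟩
  obtain ⟨φ, hφ⟩ := (baer_divisibleElements htf).extension_property_addMonoidHom
    (Finsupp.coeFnAddHom : (ℕ →₀ ℤ) →+ ℕ → ℤ) DFunLike.coe_injective
    (Finsupp.liftAddHom fun _ => zmultiplesHom _ (⟨a, ha⟩ : divisibleElements A))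
  obtain ⟨i, hi⟩ := h.exists_apply_single_eq_zero ((divisibleElements A).subtype.comp φ)
  have h1 : φ (Pi.single i 1) = Finsupp.liftAddHom
      (fun _ => zmultiplesHom _ (⟨a, ha⟩ : divisibleElements A)) (Finsupp.single i 1) := by
    rw [← Finsupp.single_eq_pi_single]
    exact DFunLike.congr_fun hφ (Finsupp.single i 1)
  rw [AddMonoidHom.comp_apply, h1] at hi
  simpa using hi

/-- Moves additive test groups in `Type` to the universe and multiplicative notation of the
definition. -/
theorem IsLCHSlender.isOpen_setOf_eq_zero {A : Type u} [AddCommGroup A]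
    (h : IsLCHSlender.{u, w} (Multiplicative A)) {H : Type} [AddCommGroup H] [TopologicalSpace H]
    [IsTopologicalAddGroup H] [LocallyCompactSpace H] [T2Space H] (φ : H →+ A) :
    IsOpen {x | φ x = 0} := by
  have : T2Space (Multiplicative H) := inferInstanceAs (T2Space H)
  have : LocallyCompactSpace (ULift.{w} (Multiplicative H)) :=
    (show IsClosedEmbedding (fun x : ULift.{w} (Multiplicative H) => (x.down.toAdd : H)) from
      IsClosedEmbedding.uliftDown).locallyCompactSpace
  have h1 := h (ULift.{w} (Multiplicative H))
    ((AddMonoidHom.toMultiplicative φ).comp MulEquiv.ulift.toMonoidHom)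
  exact h1.preimage (continuous_uliftUp.comp continuous_ofAdd)

theorem IsCMSlender.isOpen_setOf_eq_zero {A : Type u} [AddCommGroup A]
    (h : IsCMSlender.{u, v} (Multiplicative A)) {H : Type} [AddCommGroup H] [TopologicalSpace H]
    [IsTopologicalAddGroup H] [TopologicalSpace.IsCompletelyMetrizableSpace H] (φ : H →+ A) :
    IsOpen {x | φ x = 0} := by
  have : TopologicalSpace.IsCompletelyMetrizableSpace (ULift.{v} (Multiplicative H)) :=
    (show IsClosedEmbedding (fun x : ULift.{v} (Multiplicative H) => (x.down.toAdd : H)) from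
      IsClosedEmbedding.uliftDown).IsCompletelyMetrizableSpace
  have h1 := h (ULift.{v} (Multiplicative H))
    ((AddMonoidHom.toMultiplicative φ).comp MulEquiv.ulift.toMonoidHom)
  exact h1.preimage (continuous_uliftUp.comp continuous_ofAdd)

theorem exists_forall_mem_of_mem_nhds_pi {X : Type*} [TopologicalSpace X] {a : ℕ → X}
    {s : Set (ℕ → X)} (hs : s ∈ 𝓝 a) : ∃ n, ∀ x : ℕ → X, (∀ i < n, x i = a i) → x ∈ s := by
  rw [nhds_pi, mem_pi'] at hs
  obtain ⟨I, t, ht, hts⟩ := hs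
  refine ⟨I.sup id + 1, fun x hx => hts fun i hi => ?_⟩
  rw [hx i (Nat.lt_succ_of_le (Finset.le_sup (f := id) hi))]
  exact mem_of_mem_nhds (ht i)

theorem IsCMSlender.isSlender {A : Type u} [AddCommGroup A]
    (h : IsCMSlender.{u, v} (Multiplicative A)) : IsSlender A := by
  intro φ
  obtain ⟨n, hn⟩ := exists_forall_mem_of_mem_nhds_pi
    ((h.isOpen_setOf_eq_zero φ).mem_nhds (x := 0) φ.map_zero)
  refine ⟨n, fun x => sub_eq_zero.1 ?_⟩
  rw [← map_sub]
  refine hn _ fun i hi => ?_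
  simp [hi]

/-- The test groups are the compact group `(ZMod p)^ℕ` and the connected group `ℝ`, where an open
kernel is everything although 1 is sent to `a`. -/
theorem IsLCHSlender.isTorsionFreeReduced {A : Type u} [AddCommGroup A]
    (h : IsLCHSlender.{u, w} (Multiplicative A)) : IsTorsionFreeReduced A := by
  have htf : ∀ n : ℕ, n ≠ 0 → ∀ a : A, n • a = 0 → a = 0 := by
    intro n hn a hna
    by_contra ha
    obtain ⟨p, hp, φ, hφ⟩ := exists_addMonoidHom_of_torsion hn ha hna
    have := Fact.mk hp
    obtain ⟨i, hi⟩ := exists_forall_mem_of_mem_nhds_pi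
      ((h.isOpen_setOf_eq_zero φ).mem_nhds (x := 0) φ.map_zero)
    exact hφ i (hi _ fun j hj => Pi.single_eq_of_ne hj.ne _)
  refine ⟨htf, exists_not_divisible_of_forall fun a ha => ?_⟩
  obtain ⟨φ, hφ⟩ := (baer_divisibleElements htf).extension_property_addMonoidHom
    (Int.castAddHom ℝ) Int.cast_injective (zmultiplesHom _ (⟨a, ha⟩ : divisibleElements A))
  have hopen := h.isOpen_setOf_eq_zero ((divisibleElements A).subtype.comp φ)
  have huniv := (show IsClopen (((divisibleElements A).subtype.comp φ).ker : Set ℝ) from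
    ⟨AddSubgroup.isClosed_of_isOpen _ hopen, hopen⟩).eq_univ ⟨0, zero_mem _⟩
  have h1 : (1 : ℝ) ∈ ((divisibleElements A).subtype.comp φ).ker :=
    huniv.ge (Set.mem_univ (1 : ℝ))
  have h2 : φ ((1 : ℤ) : ℝ) = zmultiplesHom _ (⟨a, ha⟩ : divisibleElements A) 1 :=
    DFunLike.congr_fun hφ 1
  rw [Int.cast_one] at h2
  rw [AddMonoidHom.mem_ker, AddMonoidHom.comp_apply, h2] at h1
  simpa using h1

/-! ### Words with prescribed truncations. -/

namespace HawaiianEarring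

namespace Word

theorem truncList_congr {M N : ℕ} (W : Word)
    (h : ∀ i, (W.letter i).1 < M ↔ (W.letter i).1 < N) : W.truncList M = W.truncList N := by
  obtain ⟨L, hs, hm, hL⟩ := exists_sorted N W
  rw [hL, truncList_eq M W L hs fun i => (hm i).trans (h i).symm]

theorem truncList_eq_nil {N : ℕ} (W : Word) (h : ∀ i, N ≤ (W.letter i).1) :
    W.truncList N = [] := by
  rw [truncList_eq N W [] List.Pairwise.nil fun i => by simpa using h i, List.map_nil]

theorem filter_truncList_succ (N : ℕ) (W : Word) :
    (W.truncList (N + 1)).filter (fun x => x.1 < N) = W.truncList N := by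
  obtain ⟨L, hs, hm, hL⟩ := exists_sorted (N + 1) W
  rw [hL, truncList_eq N W (L.filter fun i => (W.letter i).1 < N) (hs.filter _), List.filter_map]
  · rfl
  · intro i
    rw [List.mem_filter, hm, decide_eq_true_iff]
    omega

/-- The subword of `W` at the positions in `s`. -/
def sub (W : Word) (s : Set W.carrier) : Word where
  carrier := s
  letter := fun i => W.letter i
  finite_letter := fun N => (W.finite_letter N).preimage Subtype.val_injective.injOn

theorem truncList_sub (N : ℕ) (W : Word) (s : Set W.carrier) :
    ∃ L : List W.carrier, L.Pairwise (· < ·) ∧ (∀ i, i ∈ L ↔ (W.letter i).1 < N ∧ i ∈ s) ∧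
      (W.sub s).truncList N = L.map W.letter := by
  obtain ⟨L, hs, hm, hL⟩ := exists_sorted N (W.sub s)
  let f : (W.sub s).carrier → W.carrier := Subtype.val
  refine ⟨L.map f, ?_, ?_, ?_⟩
  · rw [List.pairwise_map]
    exact hs.imp fun h => h
  · intro i
    rw [List.mem_map]
    constructor
    · rintro ⟨j, hj, rfl⟩
      exact ⟨(hm j).1 hj, j.2⟩
    · rintro ⟨h1, h2⟩
      exact ⟨⟨i, h2⟩, (hm _).2 h1, rfl⟩
  · rw [hL, List.map_map]
    rfl

theorem toFree_sub_union (N : ℕ) (W : Word) (s t : Set W.carrier)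
    (hst : ∀ i ∈ s, ∀ j ∈ t, i < j) :
    (W.sub (s ∪ t)).toFree N = (W.sub s).toFree N * (W.sub t).toFree N := by
  obtain ⟨L, hs, hm, hL⟩ := truncList_sub N W (s ∪ t)
  obtain ⟨L₁, hs₁, hm₁, hL₁⟩ := truncList_sub N W s
  obtain ⟨L₂, hs₂, hm₂, hL₂⟩ := truncList_sub N W t
  have hs' : (L₁ ++ L₂).Pairwise (· < ·) := List.pairwise_append.2 ⟨hs₁, hs₂, fun i hi j hj =>
    hst i ((hm₁ i).1 hi).2 j ((hm₂ j).1 hj).2⟩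
  have hLL : L = L₁ ++ L₂ := by
    refine List.Perm.eq_of_pairwise' (r := (· ≤ ·)) (hs.imp le_of_lt) (hs'.imp le_of_lt) ?_
    rw [List.perm_ext_iff_of_nodup (hs.imp ne_of_lt) (hs'.imp ne_of_lt)]
    intro i
    rw [List.mem_append, hm, hm₁, hm₂, ← and_or_left]
    rfl
  unfold toFree
  rw [hL, hL₁, hL₂, hLL, List.map_append, FreeGroup.mul_mk]

theorem toFree_sub_univ (N : ℕ) (W : Word) : (W.sub Set.univ).toFree N = W.toFree N := by
  obtain ⟨L, hs, hm, hL⟩ := truncList_sub N W Set.univ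
  unfold toFree
  rw [hL, truncList_eq N W L hs fun i => by simp [hm]]

/-- `P` places some letters of `L` at increasing rationals; density of `ℚ` leaves room for the
others without moving these. The lower bound `a` keeps the tail to the right of the letters already
placed in the induction. -/
theorem exists_strictMono_extension {α : Type*} (p : α → Bool) (L : List α) (a : ℚ)
    (P : List (ℚ × α)) (hP : P.map Prod.snd = L.filter p) (hs : P.Pairwise (fun x y => x.1 < y.1))
    (ha : ∀ x ∈ P, a < x.1) :
    ∃ Q : List (ℚ × α), Q.map Prod.snd = L ∧ Q.filter (fun x => p x.2) = P ∧
      Q.Pairwise (fun x y => x.1 < y.1) ∧ ∀ x ∈ Q, a < x.1 := by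
  induction L generalizing a P with
  | nil => exact ⟨[], rfl, (List.map_eq_nil_iff.1 hP).symm, List.Pairwise.nil, by simp⟩
  | cons x L ih =>
    cases hx : p x with
    | false =>
      rw [List.filter_cons_of_neg (by simp [hx])] at hP
      obtain ⟨b, hab, hb⟩ : ∃ b, a < b ∧ ∀ y ∈ P, b < y.1 := by
        cases P with
        | nil => exact ⟨a + 1, by linarith, by simp⟩
        | cons y P =>
          obtain ⟨b, hab, hb⟩ := exists_between (ha y (by simp))
          refine ⟨b, hab, fun z hz => ?_⟩
          rcases List.mem_cons.1 hz with rfl | hz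
          · exact hb
          · exact hb.trans ((List.pairwise_cons.1 hs).1 z hz)
      obtain ⟨Q, hQ1, hQ2, hQ3, hQ4⟩ := ih b P hP hs hb
      refine ⟨(b, x) :: Q, by simp [hQ1], ?_, List.pairwise_cons.2 ⟨hQ4, hQ3⟩, ?_⟩
      · rw [List.filter_cons_of_neg (by simp [hx]), hQ2]
      · intro y hy
        rcases List.mem_cons.1 hy with rfl | hy
        · exact hab
        · exact hab.trans (hQ4 y hy)
    | true =>
      rw [List.filter_cons_of_pos hx] at hP
      obtain ⟨y, P, rfl, rfl, hP'⟩ := List.map_eq_cons_iff.1 hP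
      obtain ⟨Q, hQ1, hQ2, hQ3, hQ4⟩ := ih y.1 P hP' (List.pairwise_cons.1 hs).2
        (List.pairwise_cons.1 hs).1
      refine ⟨y :: Q, by simp [hQ1], ?_, List.pairwise_cons.2 ⟨hQ4, hQ3⟩, ?_⟩
      · rw [List.filter_cons_of_pos (p := fun x : ℚ × α => p x.2) hx, hQ2]
      · intro z hz
        rcases List.mem_cons.1 hz with rfl | hz
        · exact ha _ (by simp)
        · exact (ha y (by simp)).trans (hQ4 z hz)

theorem filter_eq_of_le {α : Type*} (d : α → ℕ) (L : ℕ → List α)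
    (hL : ∀ N, (L (N + 1)).filter (fun x => d x < N) = L N) {M N : ℕ} (h : M ≤ N) :
    (L N).filter (fun x => d x < M) = L M := by
  induction N, h using Nat.le_induction with
  | base =>
    rw [List.filter_eq_self]
    intro x hx
    rw [← hL M] at hx
    exact (List.mem_filter.1 hx).2
  | succ N hMN ih =>
    rw [← ih, ← hL N, List.filter_filter]
    refine List.filter_congr fun x _ => ?_
    by_cases hx : d x < M
    · simp [hx, hx.trans_le hMN]
    · simp [hx]

/-- A coherent sequence of finite words is the sequence of truncations of a word. -/
theorem exists_truncList_eq (L : ℕ → List (ℕ × Bool))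
    (hL : ∀ N, (L (N + 1)).filter (fun x => x.1 < N) = L N) :
    ∃ W : Word, ∀ N, W.truncList N = L N := by
  let T (N : ℕ) : Type := {P : List (ℚ × (ℕ × Bool)) //
    P.map Prod.snd = L N ∧ P.Pairwise (fun x y => x.1 < y.1)}
  have hstep : ∀ N (P : T N), ∃ Q : T (N + 1), Q.1.filter (fun x => x.2.1 < N) = P.1 := by
    rintro N ⟨P, hP, hs⟩
    obtain ⟨a, ha⟩ : ∃ a : ℚ, ∀ x ∈ P, a < x.1 := by
      cases P with
      | nil => exact ⟨0, by simp⟩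
      | cons y P =>
        refine ⟨y.1 - 1, fun z hz => ?_⟩
        rcases List.mem_cons.1 hz with rfl | hz
        · linarith
        · linarith [(List.pairwise_cons.1 hs).1 z hz]
    obtain ⟨Q, hQ1, hQ2, hQ3, -⟩ := exists_strictMono_extension (fun x : ℕ × Bool => x.1 < N)
      (L (N + 1)) a P (by rw [hP, hL]) hs ha
    exact ⟨⟨Q, hQ1, hQ3⟩, hQ2⟩
  choose F hF using hstep
  have hL0 : L 0 = [] := by rw [← hL 0]; simp
  let P : ∀ N, T N := fun N => Nat.rec ⟨[], by simp [hL0], List.Pairwise.nil⟩ F N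
  have hP : ∀ N, (P (N + 1)).1.filter (fun x => x.2.1 < N) = (P N).1 := fun N => hF N (P N)
  have hfilter : ∀ {M N}, M ≤ N → (P N).1.filter (fun x => x.2.1 < M) = (P M).1 := fun h =>
    filter_eq_of_le (fun x : ℚ × (ℕ × Bool) => x.2.1) (fun N => (P N).1) hP h
  have hlt : ∀ {N x}, x ∈ (P N).1 → x.2.1 < N := by
    intro N x hx
    rw [← hfilter le_rfl] at hx
    simpa using (List.mem_filter.1 hx).2
  have hmem : ∀ M N x, x ∈ (P M).1 → x.2.1 < N → x ∈ (P N).1 := by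
    intro M N x hx hxN
    rcases le_total M N with h | h
    · rw [← hfilter h] at hx
      exact (List.mem_filter.1 hx).1
    · rw [← hfilter h]
      exact List.mem_filter.2 ⟨hx, by simpa using hxN⟩
  -- The positions are the union of all `P N`, ordered by their rationals: a placed letter of index
  -- `n` occurring in some `P N` occurs in exactly those with `N > n`, so testing `P (n + 1)`
  -- suffices.
  let C : Type := {x : ℚ × (ℕ × Bool) // x ∈ (P (x.2.1 + 1)).1}
  have hinj : Function.Injective (fun x : C => x.1.1) := by
    intro x y hxy
    by_contra hne
    have hne' : x.1 ≠ y.1 := fun h => hne (Subtype.ext h)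
    have hx : x.1 ∈ (P (max x.1.2.1 y.1.2.1 + 1)).1 := hmem (x.1.2.1 + 1) _ x.1 x.2 (Nat.lt_succ_of_le (le_max_left _ _))
    have hy : y.1 ∈ (P (max x.1.2.1 y.1.2.1 + 1)).1 := hmem (y.1.2.1 + 1) _ y.1 y.2 (Nat.lt_succ_of_le (le_max_right _ _))
    have hp : (P (max x.1.2.1 y.1.2.1 + 1)).1.Pairwise (fun a b => a.1 ≠ b.1) :=
      (P (max x.1.2.1 y.1.2.1 + 1)).2.2.imp fun h => ne_of_lt h
    have : Std.Symm (fun a b : ℚ × (ℕ × Bool) => a.1 ≠ b.1) := ⟨fun _ _ h => h.symm⟩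
    exact hp.forall hx hy hne' hxy
  let W : Word :=
    { carrier := C
      order := LinearOrder.lift' (fun x : C => x.1.1) hinj
      countable := Subtype.countable
      letter := fun x => x.1.2
      finite_letter := fun N => by
        refine ((P N).1.finite_toSet.preimage (f := fun x : C => x.1)
          Subtype.val_injective.injOn).subset fun x hx => ?_
        exact hmem (x.1.2.1 + 1) _ x.1 x.2 hx }
  refine ⟨W, fun N => ?_⟩
  have hC : ∀ x ∈ (P N).1, x ∈ (P (x.2.1 + 1)).1 := fun x hx => hmem _ _ _ hx (Nat.lt_succ_self _)
  rw [truncList_eq N W ((P N).1.pmap (fun x hx => (⟨x, hx⟩ : C)) hC), List.map_pmap]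
  · exact (List.pmap_eq_map hC).trans (P N).2.1
  · refine List.Pairwise.pmap (P N).2.2 hC ?_
    exact fun x _ y _ h => h
  · intro i
    rw [List.mem_pmap]
    constructor
    · rintro ⟨x, hx, rfl⟩
      exact hlt hx
    · exact fun hi => ⟨i.1, hmem (i.1.2.1 + 1) _ i.1 i.2 hi, rfl⟩

end Word

/-! ### From coherent sequences of finite words to n-slenderness. -/

/-- The inverse limit of the free monoids of finite words: coherent sequences of finite words. -/
def coherentLists : Submonoid (ℕ → FreeMonoid (ℕ × Bool)) where
  carrier := {L | ∀ N, FreeMonoid.ofList ((L (N + 1)).toList.filter (fun x => x.1 < N)) = L N}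
  one_mem' := fun _ => rfl
  mul_mem' := fun {L K} hL hK N => by
    rw [Pi.mul_apply, Pi.mul_apply, FreeMonoid.toList_mul, List.filter_append,
      FreeMonoid.ofList_append, hL, hK]

namespace HEG

/-- The class of a word depends only on its truncations, so arbitrary choices of words realizing the
sequences are multiplicative on classes. -/
theorem exists_monoidHom_coherentLists : ∃ θ : coherentLists →* HEG,
    ∀ (W : Word) (L : coherentLists), (∀ N, FreeMonoid.ofList (W.truncList N) = L.1 N) →
      θ L = mk W := by
  have hex : ∀ L : coherentLists, ∃ W : Word, ∀ N, W.truncList N = (L.1 N).toList := fun L =>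
    Word.exists_truncList_eq _ L.2
  choose w hw using hex
  refine ⟨⟨⟨fun L => mk (w L), sound fun N => ?_⟩, fun L K => sound fun N => ?_⟩,
    fun W L h => sound fun N => ?_⟩
  · rw [Word.toFree_empty, Word.toFree, hw]
    rfl
  · rw [Word.toFree_concat, Word.toFree, Word.toFree, Word.toFree, hw, hw, hw, FreeGroup.mul_mk]
    rfl
  · rw [Word.toFree, Word.toFree, hw, ← h]
    rfl

theorem retract_mk_of_lt (N : ℕ) (W : Word) (h : ∀ i, (W.letter i).1 < N) :
    retract N (mk W) = mk W := by
  rw [retract_mk]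
  refine sound fun M => ?_
  rw [Word.toFree_restrict, Word.toFree, Word.toFree, Word.truncList_congr]
  intro i
  rw [lt_min_iff, and_iff_left (h i)]

theorem retract_mk_of_le (N : ℕ) (W : Word) (h : ∀ i, N ≤ (W.letter i).1) :
    retract N (mk W) = 1 := by
  rw [retract_mk, one_def]
  refine sound fun M => ?_
  rw [Word.toFree_restrict, Word.toFree_empty, Word.toFree,
    Word.truncList_eq_nil W fun i => (min_le_right _ _).trans (h i)]
  rfl

theorem mk_sub_union (W : Word) (s t : Set W.carrier) (hst : ∀ i ∈ s, ∀ j ∈ t, i < j) :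
    mk (W.sub (s ∪ t)) = mk (W.sub s) * mk (W.sub t) :=
  sound fun N => by rw [Word.toFree_sub_union N W s t hst, Word.toFree_concat]

/-- A homomorphism that kills the words in the letters `a_n`, `n ≥ N`, factors through the
retraction onto the free group on the other letters. -/
theorem eq_comp_retract {G : Type*} [Group G] (φ : HEG →* G) (N : ℕ)
    (h : ∀ W : Word, (∀ i, N ≤ (W.letter i).1) → φ (mk W) = 1) : φ = φ.comp (retract N) := by
  -- Induction on the number of letters of index below `N` in `s`: cutting at such a letter leaves
  -- two subwords with fewer of them, and `eqLocus` is closed under products.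
  have key : ∀ (W : Word) (k : ℕ) (s : Set W.carrier), ({i | (W.letter i).1 < N} ∩ s).ncard = k →
      mk (W.sub s) ∈ φ.eqLocus (φ.comp (retract N)) := by
    intro W k
    induction k using Nat.strong_induction_on with
    | _ k ih =>
      intro s hk
      by_cases hs : ∃ i ∈ s, (W.letter i).1 < N
      · obtain ⟨i, his, hi⟩ := hs
        have hfin : ({i | (W.letter i).1 < N} ∩ s).Finite :=
          (W.finite_letter N).subset Set.inter_subset_left
        have hless : ∀ t ⊆ s, i ∉ t → mk (W.sub t) ∈ φ.eqLocus (φ.comp (retract N)) := by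
          intro t hts hit
          refine ih _ ?_ t rfl
          rw [← hk]
          exact Set.ncard_lt_ncard ⟨Set.inter_subset_inter_right _ hts,
            fun hsub => hit (hsub ⟨hi, his⟩).2⟩ hfin
        have hsingle : mk (W.sub {i}) ∈ φ.eqLocus (φ.comp (retract N)) := by
          change φ _ = φ (retract N _)
          rw [retract_mk_of_lt]
          rintro ⟨j, rfl⟩
          exact hi
        have hsplit : s = (s ∩ Set.Iio i) ∪ ({i} ∪ (s ∩ Set.Ioi i)) := by
          ext j
          rcases lt_trichotomy j i with hj | rfl | hj
          · simp [hj, hj.ne, hj.not_gt]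
          · simp [his]
          · simp [hj, hj.ne', hj.not_gt]
        rw [hsplit, mk_sub_union, mk_sub_union]
        · exact mul_mem (hless _ Set.inter_subset_left (by simp))
            (mul_mem hsingle (hless _ Set.inter_subset_left (by simp)))
        · rintro j rfl l hl
          exact hl.2
        · rintro j hj l (rfl | hl)
          · exact hj.2
          · exact lt_trans hj.2 hl.2
      · have hs' : ∀ i : (W.sub s).carrier, N ≤ ((W.sub s).letter i).1 := fun i =>
          not_lt.1 fun hi => hs ⟨i.1, i.2, hi⟩
        change φ _ = φ (retract N _)
        rw [retract_mk_of_le N _ hs', h _ hs', map_one]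
  refine MonoidHom.ext fun g => ?_
  induction g using Quotient.inductionOn with | _ W
  have := key W _ Set.univ rfl
  rwa [show mk (W.sub Set.univ) = mk W from sound fun N => Word.toFree_sub_univ N W] at this

end HEG

end HawaiianEarring

open HawaiianEarring in
-- Coherent sequences form a closed submonoid of a countable product of discrete monoids, so the
-- metrizable case applies to `φ.comp θ`. A word in letters of index at least `n` has empty
-- truncations up to `n`, hence lies in a small neighbourhood of 1.
theorem IsTorsionFreeReduced.isNSlender {A : Type u} [AddCommGroup A]
    (h : IsTorsionFreeReduced A) (hA : Cardinal.mk A < Cardinal.continuum.{u}) :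
    IsNSlender (Multiplicative A) := by
  intro φ
  obtain ⟨θ, hθ⟩ := HEG.exists_monoidHom_coherentLists
  let _ : TopologicalSpace (FreeMonoid (ℕ × Bool)) := ⊥
  have : DiscreteTopology (FreeMonoid (ℕ × Bool)) := ⟨rfl⟩
  have hclosed : IsClosed (coherentLists : Set (ℕ → FreeMonoid (ℕ × Bool))) := by
    change IsClosed {L : ℕ → FreeMonoid (ℕ × Bool) |
      ∀ N, FreeMonoid.ofList ((L (N + 1)).toList.filter (fun x => x.1 < N)) = L N}
    rw [Set.ofPred_forall]
    refine isClosed_iInter fun N => isClosed_eq ?_ (continuous_apply N)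
    exact (continuous_of_discreteTopology (f := fun l : FreeMonoid (ℕ × Bool) =>
      FreeMonoid.ofList (l.toList.filter (fun x => x.1 < N)))).comp (continuous_apply (N + 1))
  have : TopologicalSpace.IsCompletelyMetrizableSpace coherentLists :=
    hclosed.isClosedEmbedding_subtypeVal.IsCompletelyMetrizableSpace
  have hev := h.eventually_eq_one_of_isCompletelyMetrizable hA (φ.comp θ)
  obtain ⟨U, hU, hUsub⟩ := (mem_nhds_subtype _ _ _).1 hev
  obtain ⟨n, hn⟩ := exists_forall_mem_of_mem_nhds_pi hU
  refine ⟨n, HEG.eq_comp_retract φ n fun W hW => ?_⟩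
  let L : coherentLists := ⟨fun N => FreeMonoid.ofList (W.truncList N), fun N =>
    congrArg FreeMonoid.ofList (W.filter_truncList_succ N)⟩
  rw [← hθ W L fun _ => rfl]
  refine hUsub (a := L) (hn _ fun i hi => ?_)
  change FreeMonoid.ofList (W.truncList i) = 1
  rw [W.truncList_eq_nil fun j => hi.le.trans (hW j)]
  rfl

/-! ### Exponent sums, from n-slender to slender. -/

namespace HawaiianEarring

/-- The exponent sum of the letter `a_n` in an element of the free group. -/
def exponentSum (n : ℕ) : FreeGroup ℕ →* Multiplicative ℤ :=
  FreeGroup.lift fun k => Multiplicative.ofAdd (if k = n then 1 else 0)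

/-- The homomorphism from the Hawaiian earring group to the group of integer sequences given by
the exponent sums of all letters. -/
noncomputable def HEG.exponentSums : HEG →* Multiplicative (ℕ → ℤ) :=
  -- `n + 1` is the first truncation level that retains the letter `a_n`.
  MonoidHom.mk' (fun g => Multiplicative.ofAdd fun n => (Quotient.lift
      (fun W : Word => exponentSum n (W.toFree (n + 1)))
      (fun _ _ h => by rw [h (n + 1)]) g).toAdd)
    (fun a b => by
      induction a using Quotient.inductionOn with | _ U
      induction b using Quotient.inductionOn with | _ V
      refine Multiplicative.toAdd.injective (funext fun n => ?_)
      change (exponentSum n ((U.concat V).toFree (n + 1))).toAdd = _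
      rw [Word.toFree_concat, map_mul]
      rfl)

theorem HEG.exponentSums_mk (W : Word) (n : ℕ) :
    (HEG.exponentSums (HEG.mk W)).toAdd n = (exponentSum n (W.toFree (n + 1))).toAdd := rfl

/-- The finite word `a_0 ^ x 0 ⋯ a_{N-1} ^ x (N-1)`. -/
def powList (x : ℕ → ℤ) : ℕ → List (ℕ × Bool)
  | 0 => []
  | N + 1 => powList x N ++ List.replicate (x N).natAbs (N, decide (0 ≤ x N))

theorem lt_of_mem_powList (x : ℕ → ℤ) {N : ℕ} {y : ℕ × Bool} (hy : y ∈ powList x N) :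
    y.1 < N := by
  induction N with
  | zero => simp [powList] at hy
  | succ N ih =>
    rcases List.mem_append.1 hy with hy | hy
    · exact (ih hy).trans (Nat.lt_succ_self N)
    · rw [List.eq_of_mem_replicate hy]
      exact Nat.lt_succ_self N

theorem filter_powList_succ (x : ℕ → ℤ) (N : ℕ) :
    (powList x (N + 1)).filter (fun y => y.1 < N) = powList x N := by
  rw [powList, List.filter_append, List.filter_eq_self.2 fun y hy => by
    simpa using lt_of_mem_powList x hy, List.filter_eq_nil_iff.2 fun y hy => by
    rw [List.eq_of_mem_replicate hy]; simp, List.append_nil]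

theorem mk_replicate {α : Type*} (a : α) (b : Bool) (k : ℕ) :
    FreeGroup.mk (List.replicate k (a, b)) = FreeGroup.mk [(a, b)] ^ k := by
  induction k with
  | zero => rfl
  | succ k ih => rw [pow_succ', ← ih, FreeGroup.mul_mk]; rfl

theorem exponentSum_powList (x : ℕ → ℤ) (n N : ℕ) :
    (exponentSum n (FreeGroup.mk (powList x N))).toAdd = if n < N then x n else 0 := by
  induction N with
  | zero => simp only [powList, Nat.not_lt_zero, if_false]; rfl
  | succ N ih =>
    rw [powList, ← FreeGroup.mul_mk, map_mul, toAdd_mul, ih, mk_replicate, map_pow, toAdd_pow]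
    have h1 : ∀ b, (exponentSum n (FreeGroup.mk [(N, b)])).toAdd =
        bif b then (if N = n then 1 else 0) else -(if N = n then 1 else 0) := by
      intro b
      cases b <;> simp [exponentSum, FreeGroup.lift_mk]
    rw [h1]
    rcases lt_trichotomy n N with h | rfl | h
    · simp [h, h.ne', h.trans (Nat.lt_succ_self N)]
    · rcases le_or_gt 0 (x n) with hx | hx
      · simp [hx]
      · simp [hx.not_ge, abs_of_neg hx]
    · simp [h.not_gt, h.ne, show ¬ n < N + 1 by omega]

/-- The witness is the infinite word `a_0 ^ x 0 * a_1 ^ x 1 * ⋯`, on which `retract N` corresponds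
to truncating `x`. -/
theorem HEG.exists_exponentSums_eq (x : ℕ → ℤ) : ∃ g : HEG,
    HEG.exponentSums g = Multiplicative.ofAdd x ∧ ∀ N, HEG.exponentSums (HEG.retract N g) =
      Multiplicative.ofAdd fun i => if i < N then x i else 0 := by
  obtain ⟨W, hW⟩ := Word.exists_truncList_eq (powList x) (filter_powList_succ x)
  refine ⟨HEG.mk W, ?_, fun N => ?_⟩
  · refine Multiplicative.toAdd.injective (funext fun n => ?_)
    rw [exponentSums_mk, Word.toFree, hW, exponentSum_powList, if_pos (Nat.lt_succ_self n)]
    rfl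
  · refine Multiplicative.toAdd.injective (funext fun n => ?_)
    rw [retract_mk, exponentSums_mk, Word.toFree_restrict, Word.toFree, hW, exponentSum_powList]
    simp

end HawaiianEarring

open HawaiianEarring in
theorem IsNSlender.isSlender {A : Type*} [AddCommGroup A]
    (h : IsNSlender (Multiplicative A)) : IsSlender A := by
  intro φ
  obtain ⟨N, hN⟩ := h ((AddMonoidHom.toMultiplicative φ).comp HEG.exponentSums)
  refine ⟨N, fun x => ?_⟩
  obtain ⟨g, hg, hgN⟩ := HEG.exists_exponentSums_eq x
  have := DFunLike.congr_fun hN g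
  rw [MonoidHom.comp_apply, MonoidHom.comp_apply, MonoidHom.comp_apply, hg, hgN] at this
  exact this

theorem theoremC (A : Type u) [AddCommGroup A]
    (hA : Cardinal.mk A < Cardinal.continuum.{u}) :
    List.TFAE [IsSlender A,
      IsNSlender (Multiplicative A),
      IsCMSlender.{u, v} (Multiplicative A),
      IsLCHSlender.{u, w} (Multiplicative A)] := by
  tfae_have 1 → 2 := fun h => h.isTorsionFreeReduced.isNSlender hA
  tfae_have 2 → 1 := fun h => h.isSlender
  tfae_have 1 → 3 := fun h => h.isTorsionFreeReduced.isCMSlender hA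
  tfae_have 3 → 1 := fun h => h.isSlender
  tfae_have 1 → 4 := fun h => h.isTorsionFreeReduced.isLCHSlender hA
  -- With the product topology `ℤ^ℕ` is not locally compact, so the route passes through
  -- `IsTorsionFreeReduced` and cm-slenderness.
  tfae_have 4 → 1 := fun h => (h.isTorsionFreeReduced.isCMSlender.{u, 0} hA).isSlender
  tfae_finish
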